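/- Setting. Let $A\in\mathbb{R}^{p\times n}$, let $I\subseteq\{1,\dots,p\}^2$ be a symmetric index set containing the diagonal, and let $t=(|I|+p)/2$ be the number of $(i,j)\in I$ with $i\le j$; label the coordinates of $\mathbb{R}^t$ by these pairs. Let $L$ map a symmetric matrix $\Omega$ to the vector $(\Omega_{ij})_{i\le j,\,(i,j)\in I}\in\mathbb{R}^t$, and let $L^\dagger:\mathbb{R}^t\to\mathbb{S}^p$ map $\omega$ to the symmetric matrix that is zero outside $I$ and satisfies $L(L^\dagger\omega)=\omega$. Put $e_1=L(I_p)$, $e_2=2L(E-I_p)$ with $E$ the all-one matrix, $e_3=e_1+e_2/4$, and $S(Y)=\frac12L(YA^T+AY^T)$ for $Y\in\mathbb{R}^{p\times n}$. Write $\circ$ for the Hadamard product and use the Frobenius and Euclidean inner products and norms. Let $\lambda>0$, $\sigma>0$, $x\in\mathbb{R}^t$, $b_\lambda=\{z\in\mathbb{R}^t: e_1\circ z=0,\ |z_k|\le\lambda\ \forall k\}$, $\phi(v)=\frac{\lambda}{2}\|v\circ e_2\|_1$, let $\mathrm{Prox}_\phi(v)$ be the minimizer of $w\mapsto\phi(w)+\frac12\|w-v\|^2$,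 and let $$\psi(Y)=\inf_{z\in b_\lambda}\Big\{\tfrac12\|Y\|_F^2-\langle S(Y)+z-e_1,x\rangle+\tfrac{\sigma}{2}\|S(Y)+z-e_1\|^2\Big\},\qquad Y\in\mathbb{R}^{p\times n}.$$ Algorithm. Let $\mu\in(0,1/2)$, $\bar\eta\in(0,1)$, $\tau\in(0,1]$, $\delta\in(0,1)$ and $Y^0\in\mathbb{R}^{p\times n}$. For $j=0,1,2,\dots$: (a) choose $u_j\in\partial\mathrm{Prox}_\phi(x/\sigma-S(Y^j)+e_1)$ (Clarke generalized Jacobian, whose elements are diagonal operators identified with vectors $u\in\mathbb{R}^t$), and put $V_jD=D+\sigma L^\dagger(S(D)\circ u_j\circ e_3)A$; (b) apply the conjugate gradient method, started at $D=0$, to $V_jD=-\nabla\psi(Y^j)$, and let $D^j$ be one of its iterates satisfying $\|V_jD^j+\nabla\psi(Y^j)\|\le\min(\bar\eta,\|\nabla\psi(Y^j)\|^{1+\tau})$; (c) let $m_j$ be the smallest integer $m\ge0$ with $\psi(Y^j+\delta^mD^j)\le\psi(Y^j)+\mu\delta^m\langle\nabla\psi(Y^j),D^j\rangle$; (d) set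 $Y^{j+1}=Y^j+\delta^{m_j}D^j$. Theorem. The function $\psi$ is strongly convex and has a unique minimizer $\overline Y\in\mathbb{R}^{p\times n}$. Every infinite sequence $\{Y^j\}$ generated by the algorithm converges to $\overline Y$, and $$\|Y^{j+1}-\overline Y\|=O\big(\|Y^j-\overline Y\|^{1+\tau}\big)\qquad(j\to\infty).$$ -/

import Mathlib

open Filter Topology Asymptotics
open scoped Gradient RealInnerProductSpace Matrix

noncomputable section

namespace SSN

/-! ### General notions -/

section General

variable {E F : Type*} [NormedAddCommGroup E] [InnerProductSpace ℝ E]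
  [NormedAddCommGroup F] [InnerProductSpace ℝ F]

/-- The proximal mapping of `f`: the minimizer of `w ↦ f w + ‖w - v‖ ^ 2 / 2`. -/
def prox (f : E → ℝ) (v : E) : E :=
  Classical.epsilon fun w => IsMinOn (fun w' => f w' + (1 / 2) * ‖w' - v‖ ^ 2) Set.univ w

/-- The Clarke generalized Jacobian of `G` at `v`: the convex hull of all limits of derivatives
of `G` along sequences of points of differentiability that converge to `v`. -/
def clarkeJacobian (G : E → F) (v : E) : Set (E →L[ℝ] F) :=
  convexHull ℝ {J | ∃ w : ℕ → E, (∀ k, DifferentiableAt ℝ G (w k)) ∧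
    Tendsto w atTop (𝓝 v) ∧ Tendsto (fun k => fderiv ℝ G (w k)) atTop (𝓝 J)}

/-- The state of the conjugate gradient method: approximate solution, residual, direction. -/
structure CGState (E : Type*) where
  sol : E
  res : E
  dir : E

/-- One step of the conjugate gradient method for the operator `V`. -/
def cgStep (V : E → E) (s : CGState E) : CGState E :=
  let α : ℝ := ⟪s.res, s.res⟫ / ⟪s.dir, V s.dir⟫
  let r : E := s.res - α • V s.dir
  let β : ℝ := ⟪r, r⟫ / ⟪s.res, s.res⟫
  ⟨s.sol + α • s.dir, r, r + β • s.dir⟩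

/-- The `i`-th iterate of the conjugate gradient method for `V d = b`, started at `d = 0`.
(Once the residual vanishes, the iterates stay constant.) -/
def cgIterate (V : E → E) (b : E) (i : ℕ) : E :=
  ((cgStep V)^[i] ⟨0, b, b⟩).sol

end General

/-! ### The index set and the linear operators -/

section Operators

variable {p n : ℕ}

/-- The space `ℝ^{p × n}` with the Frobenius inner product. -/
abbrev MatSpace (p n : ℕ) : Type := EuclideanSpace ℝ (Fin p × Fin n)

/-- An element of `MatSpace p n` as a matrix. -/
def toMat (Y : MatSpace p n) : Matrix (Fin p) (Fin n) ℝ := Matrix.of fun i j => Y (i, j)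

/-- A matrix as an element of `MatSpace p n`. -/
def ofMat (M : Matrix (Fin p) (Fin n) ℝ) : MatSpace p n := WithLp.toLp 2 fun ij => M ij.1 ij.2

/-- The positions of `I` in the upper triangle, diagonal included. -/
abbrev UpperIdx (I : Finset (Fin p × Fin p)) : Type :=
  {ij : Fin p × Fin p // ij.1 ≤ ij.2 ∧ ij ∈ I}

/-- The space `ℝ^t`, its coordinates being labelled by the `t` upper triangular positions
of `I`. -/
abbrev VecSpace (I : Finset (Fin p × Fin p)) : Type := EuclideanSpace ℝ (UpperIdx I)

/-- The Hadamard product of vectors. -/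
def had {ι : Type*} (v w : EuclideanSpace ℝ ι) : EuclideanSpace ℝ ι :=
  WithLp.toLp 2 fun k => v k * w k

/-- `L`: the upper triangular entries of a symmetric matrix at the positions of `I`. -/
def opL (I : Finset (Fin p × Fin p)) (Ω : Matrix (Fin p) (Fin p) ℝ) : VecSpace I :=
  WithLp.toLp 2 fun k => Ω k.1.1 k.1.2

/-- `L†`: the symmetric matrix that vanishes outside `I` and has the given upper triangular
entries at the positions of `I`. -/
def opLdag (I : Finset (Fin p × Fin p)) (ω : VecSpace I) : Matrix (Fin p) (Fin p) ℝ :=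
  Matrix.of fun i j =>
    if h : min i j ≤ max i j ∧ (min i j, max i j) ∈ I then ω ⟨(min i j, max i j), h⟩ else 0

/-- `e₁ = L(I_p)`. -/
def e1 (I : Finset (Fin p × Fin p)) : VecSpace I := opL I 1

/-- `e₂ = 2 L(E - I_p)`, with `E` the all-one matrix. -/
def e2 (I : Finset (Fin p × Fin p)) : VecSpace I :=
  (2 : ℝ) • opL I (Matrix.of (fun _ _ => (1 : ℝ)) - 1)

/-- `e₃ = e₁ + e₂ / 4`. -/
def e3 (I : Finset (Fin p × Fin p)) : VecSpace I := e1 I + (1 / 4 : ℝ) • e2 I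

/-- `S(Y) = L(Y Aᵀ + A Yᵀ) / 2`. -/
def opS (A : Matrix (Fin p) (Fin n) ℝ) (I : Finset (Fin p × Fin p)) (Y : MatSpace p n) :
    VecSpace I :=
  (1 / 2 : ℝ) • opL I (toMat Y * Aᵀ + A * (toMat Y)ᵀ)

/-! ### The inner problem of the augmented Lagrangian method -/

/-- `b_lam = {z | e₁ ∘ z = 0, |z_k| ≤ lam for all k}`. -/
def box (I : Finset (Fin p × Fin p)) (lam : ℝ) : Set (VecSpace I) :=
  {z | had (e1 I) z = 0 ∧ ∀ k, |z k| ≤ lam}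

/-- The augmented Lagrangian `Ψ(Y, z)` at `z ∈ b_lam` (it is `+∞` at all other `z`). -/
def augLagrangian (A : Matrix (Fin p) (Fin n) ℝ) (I : Finset (Fin p × Fin p)) (σ : ℝ)
    (x : VecSpace I) (Y : MatSpace p n) (z : VecSpace I) : ℝ :=
  (1 / 2) * ‖Y‖ ^ 2 - ⟪opS A I Y + z - e1 I, x⟫ + (σ / 2) * ‖opS A I Y + z - e1 I‖ ^ 2

/-- `ψ(Y) = inf_z Ψ(Y, z)`. -/
def psi (A : Matrix (Fin p) (Fin n) ℝ) (I : Finset (Fin p × Fin p)) (σ lam : ℝ)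
    (x : VecSpace I) (Y : MatSpace p n) : ℝ :=
  ⨅ z : box I lam, augLagrangian A I σ x Y z

/-- `φ(v) = (lam / 2) ‖v ∘ e₂‖₁`, the support function of `b_lam`. -/
def phi (I : Finset (Fin p × Fin p)) (lam : ℝ) (v : VecSpace I) : ℝ :=
  (lam / 2) * ∑ k, |had v (e2 I) k|

/-! ### The semismooth Newton method -/

/-- `u ∈ ∂Prox_φ(v)`, a vector `u` standing for the diagonal operator `w ↦ u ∘ w`. -/
def MemProxJacobian (I : Finset (Fin p × Fin p)) (lam : ℝ) (v u : VecSpace I) : Prop :=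
  Matrix.toEuclideanCLM (𝕜 := ℝ) (Matrix.diagonal fun k => u k) ∈ clarkeJacobian (prox (phi I lam)) v

/-- `V D = D + σ L†(S(D) ∘ u ∘ e₃) A`. -/
def newtonOp (A : Matrix (Fin p) (Fin n) ℝ) (I : Finset (Fin p × Fin p)) (σ : ℝ)
    (u : VecSpace I) (D : MatSpace p n) : MatSpace p n :=
  D + σ • ofMat (opLdag I (had (had (opS A I D) u) (e3 I)) * A)

/-- The condition of the line search on the exponent `m`. -/
def Armijo (A : Matrix (Fin p) (Fin n) ℝ) (I : Finset (Fin p × Fin p)) (σ lam : ℝ)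
    (x : VecSpace I) (μ δ : ℝ) (Y D : MatSpace p n) (m : ℕ) : Prop :=
  psi A I σ lam x (Y + δ ^ m • D)
    ≤ psi A I σ lam x Y + μ * δ ^ m * ⟪∇ (psi A I σ lam x) Y, D⟫

/-- `Y'` results from `Y` by one iteration of the semismooth Newton method. The direction `D` may
be any conjugate gradient iterate that meets the tolerance. -/
def SSNStep (A : Matrix (Fin p) (Fin n) ℝ) (I : Finset (Fin p × Fin p)) (σ lam : ℝ)
    (x : VecSpace I) (μ ηbar τ δ : ℝ) (Y Y' : MatSpace p n) : Prop :=
  ∃ (u : VecSpace I) (D : MatSpace p n) (m : ℕ),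
    MemProxJacobian I lam ((1 / σ) • x - opS A I Y + e1 I) u ∧
    (∃ i : ℕ, D = cgIterate (newtonOp A I σ u) (-∇ (psi A I σ lam x) Y) i) ∧
    ‖newtonOp A I σ u D + ∇ (psi A I σ lam x) Y‖
      ≤ min ηbar (‖∇ (psi A I σ lam x) Y‖ ^ (1 + τ)) ∧
    IsLeast {m' : ℕ | Armijo A I σ lam x μ δ Y D m'} m ∧
    Y' = Y + δ ^ m • D

end Operators

end SSN

end

/-! Completing the square turns the infimum over the box into coordinatewise distances to intervals
`[-c_k, c_k]`, with `c_k = λ` off the diagonal and `c_k = 0` on it. Hence, with `b = x/σ + e₁`,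
`ψ(Y) = ‖Y‖²/2 + (σ/2) ∑ soft(c_k, (b - S Y)_k)²` up to a constant (`psi_eq`). This function is
1-strongly convex, and its gradient `g` obeys a quadratic upper bound with `K = 1 + σ‖S‖²`.

Semismoothness takes an exact form. Soft thresholding is piecewise affine, so for `Y` near a fixed
`Z` every generalized Hessian `V` taken at the moving point `Y` gives `g Y = g Z + V (Y - Z)`
without error, and `ψ` has the matching second order expansion (`piecewiseQuadratic_softQuad`). The
weights `e₃` make `ω ↦ L†(ω ∘ e₃) A` the adjoint of `S`, so each `V_j` is such a Hessian, with `‖D‖²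
≤ ⟪D, V_j D⟫` and `‖V_j D‖ ≤ K‖D‖`.

Conjugate gradient iterates satisfy `⟪-g, D⟫ = ⟪D, V D⟫ ≥ ‖D‖²` (`inner_cgIterate`), so step lengths
stay above `δ/K` and the decrease of `ψ` forces `D_j → 0`. The residual tolerance then gives `g(Y_j)
→ 0`, and strong convexity gives convergence (`tendsto_minimizer`). Near the minimizer, `V` maps the
error of the full step to the residual, which is at most `‖g‖^(1+τ)`. As `μ < 1/2`, the full step is
eventually accepted, which gives the rate (`isBigO_norm_sub`). -/

namespace SSN

/-! ### Orthogonality in the conjugate gradient method. -/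

section ConjugateGradient

variable {E : Type*} [NormedAddCommGroup E] [InnerProductSpace ℝ E]

/-- The state of the conjugate gradient method after `i` steps. -/
noncomputable def cgState (V : E → E) (b : E) (i : ℕ) : CGState E := (cgStep V)^[i] ⟨0, b, b⟩

/-- The step length of the conjugate gradient method. -/
noncomputable def cgAlpha (V : E → E) (b : E) (i : ℕ) : ℝ :=
  ⟪(cgState V b i).res, (cgState V b i).res⟫ / ⟪(cgState V b i).dir, V (cgState V b i).dir⟫

/-- The coefficient of the old direction in the new one. -/
noncomputable def cgBeta (V : E → E) (b : E) (i : ℕ) : ℝ :=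
  ⟪(cgState V b (i + 1)).res, (cgState V b (i + 1)).res⟫ /
    ⟪(cgState V b i).res, (cgState V b i).res⟫

lemma cgState_succ (V : E → E) (b : E) (i : ℕ) :
    cgState V b (i + 1) = cgStep V (cgState V b i) :=
  Function.iterate_succ_apply' _ _ _

lemma cgState_sol_succ (V : E → E) (b : E) (i : ℕ) :
    (cgState V b (i + 1)).sol = (cgState V b i).sol + cgAlpha V b i • (cgState V b i).dir := by
  rw [cgState_succ]; rfl

lemma cgState_res_succ (V : E → E) (b : E) (i : ℕ) :
    (cgState V b (i + 1)).res
      = (cgState V b i).res - cgAlpha V b i • V (cgState V b i).dir := by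
  rw [cgState_succ]; rfl

lemma cgState_dir_succ (V : E → E) (b : E) (i : ℕ) :
    (cgState V b (i + 1)).dir
      = (cgState V b (i + 1)).res + cgBeta V b i • (cgState V b i).dir := by
  rw [cgBeta, cgState_succ]; rfl

lemma cgState_res_eq (V : E →ₗ[ℝ] E) (b : E) (i : ℕ) :
    (cgState V b i).res = b - V (cgState V b i).sol := by
  induction i with
  | zero => simp [cgState]
  | succ i ih => rw [cgState_res_succ, cgState_sol_succ, ih, map_add, map_smul]; abel

/-- Whatever is orthogonal to the first `i` directions is orthogonal to the `i`-th iterate. -/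
lemma inner_cgState_sol_eq_zero (V : E → E) (b y : E) (i : ℕ)
    (h : ∀ j < i, ⟪y, (cgState V b j).dir⟫ = 0) : ⟪y, (cgState V b i).sol⟫ = 0 := by
  induction i with
  | zero => simp [cgState]
  | succ i ih =>
    rw [cgState_sol_succ, inner_add_right, inner_smul_right, h i (Nat.lt_succ_self i),
      ih fun j hj => h j (hj.trans (Nat.lt_succ_self i))]
    simp

/-- The orthogonality relations that hold after `i` steps of the method. -/
structure CGOrthogonal (V : E → E) (b : E) (i : ℕ) : Prop where
  res_dir : ∀ j < i, ⟪(cgState V b i).res, (cgState V b j).dir⟫ = 0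
  res_res : ∀ j < i, ⟪(cgState V b i).res, (cgState V b j).res⟫ = 0
  conj : ∀ j < i, ⟪(cgState V b i).dir, V (cgState V b j).dir⟫ = 0
  res_self : ⟪(cgState V b i).res, (cgState V b i).dir⟫
    = ⟪(cgState V b i).res, (cgState V b i).res⟫

variable {V : E →ₗ[ℝ] E} (hsymm : V.IsSymmetric) (hpos : ∀ D, ‖D‖ ^ 2 ≤ ⟪D, V D⟫)
include hpos

/-- The identity survives division by zero: a vanishing denominator forces a zero direction by
coercivity, and then `res_self` makes the residual zero as well. -/
lemma CGOrthogonal.alpha_mul {b : E} {i : ℕ} (h : CGOrthogonal V b i) :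
    cgAlpha V b i * ⟪(cgState V b i).dir, V (cgState V b i).dir⟫
      = ⟪(cgState V b i).res, (cgState V b i).res⟫ := by
  by_cases h0 : ⟪(cgState V b i).dir, V (cgState V b i).dir⟫ = 0
  · have h1 := hpos (cgState V b i).dir
    rw [h0] at h1
    have h2 : (cgState V b i).dir = 0 := by
      rw [← norm_eq_zero]; exact pow_eq_zero_iff (two_ne_zero) |>.1 (le_antisymm h1 (sq_nonneg _))
    have h3 := h.res_self
    rw [h2, inner_zero_right] at h3
    rw [h0, ← h3, mul_zero]
  · rw [cgAlpha, div_mul_cancel₀ _ h0]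

lemma CGOrthogonal.res_eq_zero {b : E} {i : ℕ} (h : CGOrthogonal V b i)
    (h0 : cgAlpha V b i = 0) : (cgState V b i).res = 0 := by
  have := h.alpha_mul hpos
  rw [h0, zero_mul] at this
  exact inner_self_eq_zero.1 this.symm

-- After termination the step length has numerator zero, so nothing changes any more.
omit hpos in
lemma cgState_res_eq_zero_of_le {b : E} {i j : ℕ} (hij : i ≤ j)
    (h : (cgState V b i).res = 0) : (cgState V b j).res = 0 := by
  induction j, hij using Nat.le_induction with
  | base => exact h
  | succ j _ ih =>
    have h0 : cgAlpha V b j = 0 := by simp [cgAlpha, ih]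
    rw [cgState_res_succ, h0, ih]; simp

include hsymm

/-- The induction is strong because the conjugacy relation with an earlier direction `j` needs the
relations at step `j` when the method has already stopped there. -/
lemma cgOrthogonal (b : E) (i : ℕ) : CGOrthogonal V b i := by
  induction i using Nat.strong_induction_on with
  | _ i ih =>
  cases i with
  | zero => exact ⟨by simp, by simp, by simp, by simp [cgState]⟩
  | succ i =>
    have hi := ih i (Nat.lt_succ_self i)
    have res_dir : ∀ j < i + 1,
        ⟪(cgState V b (i + 1)).res, (cgState V b j).dir⟫ = 0 := by
      intro j hj
      rw [cgState_res_succ, inner_sub_left, inner_smul_left, hsymm]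
      rcases Nat.lt_succ_iff_lt_or_eq.1 hj with hj | rfl
      · rw [hi.res_dir j hj, hi.conj j hj]; simp
      · rw [hi.res_self]
        simpa [sub_eq_zero] using (hi.alpha_mul hpos).symm
    have res_res : ∀ j < i + 1,
        ⟪(cgState V b (i + 1)).res, (cgState V b j).res⟫ = 0 := by
      intro j hj
      cases j with
      | zero => exact res_dir 0 hj
      | succ j =>
        have h1 := res_dir (j + 1) hj
        rw [cgState_dir_succ, inner_add_right, inner_smul_right, res_dir j (by omega)] at h1
        simpa using h1
    -- `α_j V d_j` is the difference of consecutive residuals, so conjugacy reduces to orthogonality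
    -- of residuals.
    have key : ∀ j < i + 1, cgAlpha V b j * ⟪(cgState V b (i + 1)).res, V (cgState V b j).dir⟫
        = ⟪(cgState V b (i + 1)).res, (cgState V b j).res⟫
          - ⟪(cgState V b (i + 1)).res, (cgState V b (j + 1)).res⟫ := by
      intro j _
      rw [cgState_res_succ V b j, inner_sub_right, inner_smul_right]; ring
    refine ⟨res_dir, res_res, fun j hj => ?_, ?_⟩
    · by_cases h0 : cgAlpha V b j = 0
      · have hz := (ih j hj).res_eq_zero hpos h0
        have hz' : (cgState V b (i + 1)).res = 0 := cgState_res_eq_zero_of_le (by omega) hz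
        have hb : cgBeta V b i = 0 := by simp [cgBeta, hz']
        rw [cgState_dir_succ, hz', hb]; simp
      · apply (mul_eq_zero.1 _).resolve_left h0
        rw [cgState_dir_succ, inner_add_left, inner_smul_left, mul_add, key j hj,
          res_res j hj]
        -- For `j < i` both terms vanish; for `j = i` the coefficient `β` is exactly what cancels
        -- them.
        rcases Nat.lt_succ_iff_lt_or_eq.1 hj with hj | rfl
        · rw [res_res (j + 1) (by omega), hi.conj j hj]; simp
        · have h1 := hi.alpha_mul hpos
          have h2 : ⟪(cgState V b j).res, (cgState V b j).res⟫ ≠ 0 := by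
            rw [← h1]
            refine fun h3 => h0 ?_
            rcases mul_eq_zero.1 h3 with h3 | h3
            · exact h3
            · simp [cgAlpha, h3]
          have h4 : cgBeta V b j * ⟪(cgState V b j).res, (cgState V b j).res⟫
              = ⟪(cgState V b (j + 1)).res, (cgState V b (j + 1)).res⟫ :=
            div_mul_cancel₀ _ h2
          rw [← h1] at h4
          simp only [conj_trivial]
          linarith
    · rw [cgState_dir_succ V b i, inner_add_right, inner_smul_right,
        res_dir i (Nat.lt_succ_self i)]
      simp

/-- The residual of a conjugate gradient iterate is orthogonal to the iterate. -/
theorem inner_cgIterate (b : E) (i : ℕ) :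
    ⟪b, cgIterate V b i⟫ = ⟪cgIterate V b i, V (cgIterate V b i)⟫ := by
  have h := inner_cgState_sol_eq_zero V b _ i (cgOrthogonal hsymm hpos b i).res_dir
  rw [cgState_res_eq, inner_sub_left, sub_eq_zero] at h
  rw [real_inner_comm _ (cgIterate _ _ _)]
  exact h

end ConjugateGradient

/-! ### Inexact Newton method for strongly convex piecewise quadratic functions. -/

section Convergence

variable {E : Type*} [NormedAddCommGroup E] [InnerProductSpace ℝ E]

/-- A strongly convex function `ψ` with gradient `g` whose generalized Hessians `Hess` give exact
second order expansions near every point, as they do for piecewise quadratic functions. -/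
structure PiecewiseQuadratic (ψ : E → ℝ) (g : E → E) (K : ℝ) (Hess : E → Set (E →ₗ[ℝ] E)) :
    Prop where
  one_le : 1 ≤ K
  lower : ∀ Y D, ψ Y + ⟪g Y, D⟫ + 1 / 2 * ‖D‖ ^ 2 ≤ ψ (Y + D)
  upper : ∀ Y D, ψ (Y + D) ≤ ψ Y + ⟪g Y, D⟫ + K / 2 * ‖D‖ ^ 2
  coercive : ∀ Y, ∀ V ∈ Hess Y, ∀ D, ‖D‖ ^ 2 ≤ ⟪D, V D⟫
  bounded : ∀ Y, ∀ V ∈ Hess Y, ∀ D, ‖V D‖ ≤ K * ‖D‖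
  expansion : ∀ Z, ∀ᶠ Y in 𝓝 Z, ∀ V ∈ Hess Y, g Y = g Z + V (Y - Z) ∧
    ψ Y = ψ Z + ⟪g Z, Y - Z⟫ + 1 / 2 * ⟪Y - Z, V (Y - Z)⟫

/-- One inexact Newton step with backtracking from `Y` to `Y'`. -/
def InexactNewtonStep (ψ : E → ℝ) (g : E → E) (Hess : E → Set (E →ₗ[ℝ] E)) (μ ηbar τ δ : ℝ)
    (Y Y' : E) : Prop :=
  ∃ V ∈ Hess Y, ∃ (D : E) (m : ℕ),
    ⟪g Y, D⟫ = -⟪D, V D⟫ ∧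
    ‖V D + g Y‖ ≤ min ηbar (‖g Y‖ ^ (1 + τ)) ∧
    IsLeast {m' : ℕ | ψ (Y + δ ^ m' • D) ≤ ψ Y + μ * δ ^ m' * ⟪g Y, D⟫} m ∧
    Y' = Y + δ ^ m • D

namespace PiecewiseQuadratic

variable {ψ : E → ℝ} {g : E → E} {K : ℝ} {Hess : E → Set (E →ₗ[ℝ] E)}
  (h : PiecewiseQuadratic ψ g K Hess)
include h

lemma hasGradientAt [CompleteSpace E] (Y : E) : HasGradientAt ψ (g Y) Y := by
  rw [hasGradientAt_iff_isLittleO, Asymptotics.isLittleO_iff]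
  intro c hc
  have hK : 0 < K := lt_of_lt_of_le one_pos h.one_le
  -- On this ball the quadratic remainder `K/2 ‖X - Y‖²` is at most `c ‖X - Y‖`.
  have : ∀ᶠ X in 𝓝 Y, ‖X - Y‖ < 2 * c / K := by
    have := Metric.ball_mem_nhds Y (ε := 2 * c / K) (by positivity)
    filter_upwards [this] with X hX
    simpa [dist_eq_norm] using hX
  filter_upwards [this] with X hX
  have h1 := h.lower Y (X - Y)
  have h2 := h.upper Y (X - Y)
  rw [add_sub_cancel] at h1 h2
  rw [Real.norm_eq_abs, abs_le]
  rw [lt_div_iff₀ hK] at hX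
  have h3 := norm_nonneg (X - Y)
  constructor
  · nlinarith [sq_nonneg ‖X - Y‖, mul_nonneg hc.le h3]
  · nlinarith

/-- The lower bounds at the convex combination `Z`, added with weights `a` and `b`, lose their
gradient terms, and the squares combine through `a b² + b a² = a b`. -/
lemma strongConvexOn : StrongConvexOn Set.univ 1 ψ := by
  refine ⟨convex_univ, fun X _ Y _ a b ha hb hab => ?_⟩
  set Z := a • X + b • Y with hZ
  have hX : X - Z = b • (X - Y) := by
    rw [hZ, show b = 1 - a by linarith]; module
  have hY : Y - Z = -(a • (X - Y)) := by
    rw [hZ, show b = 1 - a by linarith]; module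
  have h1 := h.lower Z (X - Z)
  have h2 := h.lower Z (Y - Z)
  rw [add_sub_cancel, hX, inner_smul_right, norm_smul, mul_pow, Real.norm_eq_abs, sq_abs] at h1
  rw [add_sub_cancel, hY, inner_neg_right, inner_smul_right, norm_neg, norm_smul, mul_pow,
    Real.norm_eq_abs, sq_abs] at h2
  have h3 := mul_le_mul_of_nonneg_left h1 ha
  have h4 := mul_le_mul_of_nonneg_left h2 hb
  have hb' : b = 1 - a := by linarith
  simp only [smul_eq_mul]
  subst hb'
  nlinarith

lemma exists_forall_le [FiniteDimensional ℝ E] : ∃ Z, ∀ Y, ψ Z ≤ ψ Y := by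
  have : CompleteSpace E := FiniteDimensional.complete ℝ E
  have : ProperSpace E := FiniteDimensional.proper ℝ E
  have hc : Continuous ψ :=
    continuous_iff_continuousAt.2 fun Y => (h.hasGradientAt Y).continuousAt
  refine hc.exists_forall_le ?_
  -- Young's inequality `‖g 0‖ ‖Y‖ ≤ ‖g 0‖² + ‖Y‖²/4` absorbs the linear term.
  have h1 : ∀ Y : E, ψ 0 - ‖g 0‖ ^ 2 / 2 * 2 + 1 / 4 * ‖Y‖ ^ 2 ≤ ψ Y := by
    intro Y
    have h1 := h.lower 0 Y
    have h2 := abs_le.1 (abs_real_inner_le_norm (g 0) Y)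
    rw [zero_add] at h1
    nlinarith [sq_nonneg (‖g 0‖ - ‖Y‖ / 2)]
  refine tendsto_atTop_mono h1 ?_
  refine tendsto_atTop_add_const_left _ _ ?_
  refine Tendsto.const_mul_atTop (by norm_num) ?_
  exact (tendsto_pow_atTop two_ne_zero).comp (tendsto_norm_cocompact_atTop (E := E))

variable {Z : E} (hZ : ∀ Y, ψ Z ≤ ψ Y)
include hZ

/-- The gradient step `-g Z / K` would lower `ψ` by at least `‖g Z‖² / (2K)`. -/
lemma gradient_eq_zero : g Z = 0 := by
  have hK : 0 < K := lt_of_lt_of_le one_pos h.one_le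
  have h1 := (hZ _).trans (h.upper Z (-(K⁻¹ • g Z)))
  rw [inner_neg_right, inner_smul_right, real_inner_self_eq_norm_sq, norm_neg, norm_smul,
    mul_pow, norm_inv, Real.norm_eq_abs, abs_of_pos hK] at h1
  have h2 : K / 2 * (K⁻¹ ^ 2 * ‖g Z‖ ^ 2) = 1 / 2 * (K⁻¹ * ‖g Z‖ ^ 2) := by field_simp
  rw [h2] at h1
  have h3 : K⁻¹ * ‖g Z‖ ^ 2 ≤ 0 := by linarith
  have h4 : ‖g Z‖ ^ 2 ≤ 0 := by
    by_contra h5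
    have := mul_pos (inv_pos.2 hK) (not_le.1 h5)
    linarith
  exact norm_eq_zero.1 (pow_eq_zero_iff two_ne_zero |>.1 (le_antisymm h4 (sq_nonneg _)))

lemma isMinOn_iff (X : E) : IsMinOn ψ Set.univ X ↔ X = Z := by
  constructor
  · intro hX
    have h1 := h.lower Z (X - Z)
    rw [add_sub_cancel, h.gradient_eq_zero hZ, inner_zero_left] at h1
    have h2 : ψ X ≤ ψ Z := hX (Set.mem_univ Z)
    have h3 : ‖X - Z‖ ^ 2 ≤ 0 := by linarith
    exact sub_eq_zero.1
      (norm_eq_zero.1 (pow_eq_zero_iff two_ne_zero |>.1 (le_antisymm h3 (sq_nonneg _))))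
  · rintro rfl Y _
    exact hZ Y

/-- Adding the lower bounds based at `Z` and at `Y` gives `‖Y - Z‖² ≤ ⟪g Y, Y - Z⟫`. -/
lemma norm_sub_le_norm_gradient (Y : E) : ‖Y - Z‖ ≤ ‖g Y‖ := by
  have h1 := h.lower Z (Y - Z)
  have h2 := h.lower Y (-(Y - Z))
  rw [add_sub_cancel, h.gradient_eq_zero hZ, inner_zero_left] at h1
  rw [inner_neg_right, norm_neg, show Y + -(Y - Z) = Z by abel] at h2
  have h3 := real_inner_le_norm (g Y) (Y - Z)
  by_contra! h4
  nlinarith [norm_nonneg (g Y), norm_nonneg (Y - Z)]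

omit h hZ in
/-- A coercive operator does not shrink vectors. -/
lemma norm_le_of_coercive {V : E →ₗ[ℝ] E} (hV : ∀ D, ‖D‖ ^ 2 ≤ ⟪D, V D⟫) (D : E) :
    ‖D‖ ≤ ‖V D‖ := by
  have h1 := (hV D).trans (real_inner_le_norm _ _)
  by_contra! h2
  nlinarith [norm_nonneg (V D)]

omit hZ in
/-- The line search accepts steps that are bounded away from zero. -/
lemma step_length_ge {μ δ : ℝ} (hμ : μ < 1 / 2) (hδ : δ ∈ Set.Ioo (0 : ℝ) 1)
    {Y D : E} {m : ℕ} (hD : ‖D‖ ^ 2 ≤ -⟪g Y, D⟫)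
    (hm : IsLeast {m' : ℕ | ψ (Y + δ ^ m' • D) ≤ ψ Y + μ * δ ^ m' * ⟪g Y, D⟫} m) :
    δ / K ≤ δ ^ m := by
  have hK : 0 < K := lt_of_lt_of_le one_pos h.one_le
  cases m with
  | zero =>
    rw [pow_zero, div_le_one hK]
    exact hδ.2.le.trans h.one_le
  | succ m =>
    -- Otherwise the previous trial length satisfies `δ ^ m < 1 / K`, and the quadratic upper bound
    -- with `1 - μ > 1/2` shows that it would already have been accepted.
    by_contra! h1
    have hpos : 0 < δ ^ m := pow_pos hδ.1 m
    have h2 : δ ^ m * K < 1 := by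
      rw [pow_succ, lt_div_iff₀ hK] at h1
      nlinarith [hδ.1]
    have h3 : m ∈ {m' : ℕ | ψ (Y + δ ^ m' • D) ≤ ψ Y + μ * δ ^ m' * ⟪g Y, D⟫} := by
      refine (h.upper Y (δ ^ m • D)).trans ?_
      rw [inner_smul_right, norm_smul, mul_pow, Real.norm_eq_abs, sq_abs]
      have h4 : K / 2 * ((δ ^ m) ^ 2 * ‖D‖ ^ 2) ≤ 1 / 2 * δ ^ m * ‖D‖ ^ 2 := by
        have := mul_nonneg hpos.le (sq_nonneg ‖D‖)
        nlinarith
      have h5 : 1 / 2 * δ ^ m * ‖D‖ ^ 2 ≤ (1 - μ) * δ ^ m * ‖D‖ ^ 2 := by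
        have := mul_nonneg hpos.le (sq_nonneg ‖D‖)
        nlinarith
      have h6 : (1 - μ) * δ ^ m * ‖D‖ ^ 2 ≤ (1 - μ) * δ ^ m * -⟪g Y, D⟫ :=
        mul_le_mul_of_nonneg_left hD (mul_nonneg (by linarith) hpos.le)
      linarith
    exact absurd (hm.2 h3) (by simp)

variable {μ ηbar τ δ : ℝ} (hμ : μ ∈ Set.Ioo (0 : ℝ) (1 / 2)) (hη : ηbar ∈ Set.Ioo (0 : ℝ) 1)
    (hτ : 0 < τ) (hδ : δ ∈ Set.Ioo (0 : ℝ) 1)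
    {Y : ℕ → E} (hY : ∀ j, InexactNewtonStep ψ g Hess μ ηbar τ δ (Y j) (Y (j + 1)))
include hμ hη hτ hδ hY

/-- Global convergence of the inexact Newton method. -/
theorem tendsto_minimizer : Tendsto Y atTop (𝓝 Z) := by
  have hK : 0 < K := lt_of_lt_of_le one_pos h.one_le
  choose V hV D m hD hres hm hstep using hY
  have hDD : ∀ j, ‖D j‖ ^ 2 ≤ -⟪g (Y j), D j⟫ := fun j => by
    rw [hD, neg_neg]; exact h.coercive _ _ (hV j) _
  set κ := μ * (δ / K) with hκ
  have hκ0 : 0 < κ := mul_pos hμ.1 (div_pos hδ.1 hK)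
  have hdec : ∀ j, κ * ‖D j‖ ^ 2 ≤ ψ (Y j) - ψ (Y (j + 1)) := by
    intro j
    have h1 : ψ (Y j + δ ^ m j • D j) ≤ ψ (Y j) + μ * δ ^ m j * ⟪g (Y j), D j⟫ := (hm j).1
    rw [← hstep] at h1
    have h2 := h.step_length_ge hμ.2 hδ (hDD j) (hm j)
    have h3 : κ * ‖D j‖ ^ 2 ≤ μ * δ ^ m j * -⟪g (Y j), D j⟫ := by
      have := hμ.1
      have := pow_pos hδ.1 (m j)
      exact mul_le_mul (mul_le_mul_of_nonneg_left h2 hμ.1.le) (hDD j) (sq_nonneg _)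
        (by positivity)
    linarith
  have hanti : Antitone fun j => ψ (Y j) := antitone_nat_of_succ_le fun j => by
    have := mul_nonneg hκ0.le (sq_nonneg ‖D j‖)
    linarith [hdec j]
  have hlim := tendsto_atTop_ciInf hanti ⟨ψ Z, by rintro _ ⟨j, rfl⟩; exact hZ _⟩
  have hdiff := hlim.sub (hlim.comp (tendsto_add_atTop_nat 1))
  rw [sub_self] at hdiff
  have hDsq : Tendsto (fun j => κ * ‖D j‖ ^ 2) atTop (𝓝 0) :=
    squeeze_zero (fun j => by positivity) hdec hdiff
  have hDlim : Tendsto (fun j => ‖D j‖) atTop (𝓝 0) := by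
    have h1 := (hDsq.const_mul κ⁻¹).sqrt
    rw [mul_zero, Real.sqrt_zero] at h1
    refine h1.congr fun j => ?_
    rw [inv_mul_cancel_left₀ hκ0.ne', Real.sqrt_sq (norm_nonneg _)]
  have hKD : Tendsto (fun j => K * ‖D j‖) atTop (𝓝 0) := by simpa using hDlim.const_mul K
  have hgres : ∀ j, ‖g (Y j)‖ ≤ ‖V j (D j) + g (Y j)‖ + K * ‖D j‖ := fun j => by
    have h1 := norm_sub_le (V j (D j) + g (Y j)) (V j (D j))
    rw [add_sub_cancel_left] at h1
    linarith [h.bounded _ _ (hV j) (D j)]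
  -- Once `K‖D j‖ < (1 - ηbar)/2`, the cap `ηbar` on the residual yields `‖g‖ ≤ q < 1`. Then
  -- `‖g‖^(1+τ) ≤ q^τ ‖g‖` can be absorbed on the left of the bound `hgres`.
  set q := (1 + ηbar) / 2 with hq
  have hq0 : 0 < q := by rw [hq]; linarith [hη.1]
  have hq1 : q < 1 := by rw [hq]; linarith [hη.2]
  have hqτ : q ^ τ < 1 := Real.rpow_lt_one hq0.le hq1 hτ
  have hev : ∀ᶠ j in atTop, ‖g (Y j)‖ ≤ (1 - q ^ τ)⁻¹ * (K * ‖D j‖) := by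
    have h1 : ∀ᶠ j in atTop, K * ‖D j‖ < (1 - ηbar) / 2 :=
      hKD.eventually_lt_const (by linarith [hη.2])
    filter_upwards [h1] with j hj
    have h2 := (hres j).trans (min_le_left _ _)
    have h3 := (hres j).trans (min_le_right _ _)
    have h4 : ‖g (Y j)‖ ≤ q := by linarith [hgres j]
    have h5 : ‖g (Y j)‖ ^ (1 + τ) ≤ ‖g (Y j)‖ * q ^ τ := by
      rw [Real.rpow_one_add' (norm_nonneg _) (by linarith)]
      exact mul_le_mul_of_nonneg_left (Real.rpow_le_rpow (norm_nonneg _) h4 hτ.le)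
        (norm_nonneg _)
    rw [inv_mul_eq_div, le_div_iff₀ (by linarith)]
    linarith [hgres j]
  have hYZ : Tendsto (fun j => Y j - Z) atTop (𝓝 0) := by
    refine squeeze_zero_norm' (a := fun j => (1 - q ^ τ)⁻¹ * (K * ‖D j‖)) ?_ (by simpa using hKD.const_mul _)
    filter_upwards [hev] with j hj
    exact (h.norm_sub_le_norm_gradient hZ _).trans hj
  simpa using hYZ.add_const Z

/-- Convergence of order `1 + τ` of the inexact Newton method. -/
theorem isBigO_norm_sub : (fun j => ‖Y (j + 1) - Z‖) =O[atTop] fun j => ‖Y j - Z‖ ^ (1 + τ) := by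
  have hK : 0 < K := lt_of_lt_of_le one_pos h.one_le
  have hlim := h.tendsto_minimizer hZ hμ hη hτ hδ hY
  choose V hV D m hD hres hm hstep using hY
  have hg0 := h.gradient_eq_zero hZ
  have hexp := hlim.eventually (h.expansion Z)
  -- This makes the full-step error `w` satisfy `K‖w‖ ≤ (1/2 - μ)‖e‖`, which is what the Armijo test
  -- needs.
  have hsmall : ∀ᶠ j in atTop, K ^ (1 + τ) * ‖Y j - Z‖ ^ τ < (1 / 2 - μ) / K := by
    have h1 : Tendsto (fun j => ‖Y j - Z‖) atTop (𝓝 0) := by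
      simpa using (hlim.sub_const Z).norm
    have h2 := (h1.rpow_const (p := τ) (Or.inr hτ.le)).const_mul (K ^ (1 + τ))
    rw [Real.zero_rpow hτ.ne', mul_zero] at h2
    exact h2.eventually_lt_const (div_pos (by linarith [hμ.2]) hK)
  refine IsBigO.of_bound (K ^ (1 + τ)) ?_
  filter_upwards [hexp, hsmall] with j hj hs
  obtain ⟨hgj, hψj⟩ := hj _ (hV j)
  have hco := h.coercive _ _ (hV j)
  have hbd := h.bounded _ _ (hV j)
  rw [hg0, zero_add] at hgj
  rw [hg0, inner_zero_left, add_zero] at hψj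
  set e := Y j - Z with he
  set w := e + D j with hw
  -- Since `g (Y j) = V e` exactly, the Newton residual is `V` applied to the error after a full
  -- step.
  have hVw : V j w = V j (D j) + g (Y j) := by rw [hw, map_add, hgj, add_comm]
  have hw1 : ‖w‖ ≤ K ^ (1 + τ) * ‖e‖ ^ (1 + τ) := by
    refine (norm_le_of_coercive hco w).trans ?_
    rw [hVw]
    refine ((hres j).trans (min_le_right _ _)).trans ?_
    rw [← Real.mul_rpow hK.le (norm_nonneg _)]
    refine Real.rpow_le_rpow (norm_nonneg _) ?_ (by linarith)
    rw [hgj]; exact hbd e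
  have hw2 : ‖w‖ * K ≤ (1 / 2 - μ) * ‖e‖ := by
    rw [Real.rpow_one_add' (norm_nonneg _) (by linarith)] at hw1
    rw [lt_div_iff₀ hK] at hs
    have := mul_le_mul_of_nonneg_right hs.le (norm_nonneg e)
    have := mul_le_mul_of_nonneg_right hw1 hK.le
    linarith
  -- With `D = w - e` it suffices that `K/2 ‖w‖² ≤ (1/2 - μ)⟪e, V e⟫ + μ⟪V e, w⟫`. The terms in `w`
  -- cost at most `K‖e‖‖w‖`, which the coercive term covers.
  have harm : ψ (Y j + δ ^ 0 • D j) ≤ ψ (Y j) + μ * δ ^ 0 * ⟪g (Y j), D j⟫ := by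
    have h1 := h.upper Z w
    rw [hg0, inner_zero_left, add_zero] at h1
    have h2 : Y j + δ ^ 0 • D j = Z + w := by rw [pow_zero, one_smul, hw, he]; abel
    have h3 : D j = w - e := by rw [hw]; abel
    rw [h2, hψj, hgj, pow_zero, mul_one, h3, inner_sub_right]
    rw [real_inner_comm e (V j e)]
    have h4 := abs_le.1 (abs_real_inner_le_norm (V j e) w)
    have h5 := hco e
    have h6 : ‖V j e‖ * ‖w‖ ≤ ‖e‖ * (‖w‖ * K) := by
      have := mul_le_mul_of_nonneg_right (hbd e) (norm_nonneg w)
      linarith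
    have h7 : ‖w‖ ≤ ‖w‖ * K := le_mul_of_one_le_right (norm_nonneg _) h.one_le
    have hμ0 := hμ.1
    have hμ1 := hμ.2
    have h8 : ‖w‖ ≤ ‖e‖ := by nlinarith [norm_nonneg e]
    have h9 : K * ‖w‖ ^ 2 ≤ ‖e‖ * (‖w‖ * K) := by
      have := mul_le_mul_of_nonneg_right h8 (mul_nonneg (norm_nonneg w) hK.le)
      linarith
    have h10 : ‖e‖ * (‖w‖ * K) ≤ (1 / 2 - μ) * ‖e‖ ^ 2 := by
      have := mul_le_mul_of_nonneg_left hw2 (norm_nonneg e)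
      linarith
    have h11 : 0 ≤ ‖e‖ * (‖w‖ * K) := by positivity
    have h12 : (1 / 2 - μ) * ‖e‖ ^ 2 ≤ (1 / 2 - μ) * ⟪e, V j e⟫ :=
      mul_le_mul_of_nonneg_left h5 (by linarith)
    have h13 : -(1 / 2 * (‖e‖ * (‖w‖ * K))) ≤ μ * ⟪V j e, w⟫ := by
      have : -(‖e‖ * (‖w‖ * K)) ≤ ⟪V j e, w⟫ := by linarith [h4.1]
      nlinarith
    linarith
  have hm0 : m j = 0 := Nat.le_zero.1 ((hm j).2 harm)
  have hnext : Y (j + 1) - Z = w := by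
    rw [hstep, hm0, pow_zero, one_smul, hw, he]; abel
  rw [hnext, norm_norm, Real.norm_of_nonneg (Real.rpow_nonneg (norm_nonneg _) _)]
  exact hw1

end PiecewiseQuadratic

end Convergence

/-! ### Scalar soft thresholding and its slopes. -/

section Soft

/-- The projection onto `[-c, c]`. -/
noncomputable def clip (c t : ℝ) : ℝ := max (-c) (min t c)

/-- Soft thresholding at `c`. -/
noncomputable def soft (c t : ℝ) : ℝ := t - clip c t

/-- `u` is a generalized derivative of `soft c` at `t`; at the kinks any slope between `0` and `1`
is allowed. -/
structure IsSlope (c t u : ℝ) : Prop where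
  nonneg : 0 ≤ u
  le_one : u ≤ 1
  eq_one : c < |t| → u = 1
  eq_zero : |t| < c → u = 0

lemma clip_monotone (c : ℝ) : Monotone (clip c) := fun _ _ h =>
  max_le_max le_rfl (min_le_min h le_rfl)

lemma soft_monotone (c : ℝ) : Monotone (soft c) := by
  intro s t h
  simp only [soft, clip]
  rcases le_total s c with h1 | h1 <;> rcases le_total t c with h2 | h2 <;>
    simp only [h1, h2, min_eq_left, min_eq_right] <;>
    rcases max_cases (-c) s with ⟨h3, _⟩ | ⟨h3, _⟩ <;>
    rcases max_cases (-c) t with ⟨h4, _⟩ | ⟨h4, _⟩ <;>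
    rcases max_cases (-c) c with ⟨h5, _⟩ | ⟨h5, _⟩ <;> linarith

variable {c : ℝ}

lemma soft_of_le {t : ℝ} (hc : 0 ≤ c) (h : c ≤ t) : soft c t = t - c := by
  rw [soft, clip, min_eq_right h, max_eq_right (by linarith)]

lemma soft_of_le_neg {t : ℝ} (hc : 0 ≤ c) (h : t ≤ -c) : soft c t = t + c := by
  rw [soft, clip, min_eq_left (by linarith), max_eq_left h]; ring

lemma soft_of_abs_le {t : ℝ} (h : |t| ≤ c) : soft c t = 0 := by
  rw [abs_le] at h
  rw [soft, clip, min_eq_left h.2, max_eq_right h.1, sub_self]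

lemma abs_clip_le (hc : 0 ≤ c) (t : ℝ) : |clip c t| ≤ c :=
  abs_le.2 ⟨le_max_left _ _, max_le (by linarith) (min_le_right _ _)⟩

/-- Complementarity: where `soft` is nonzero, `clip` sits at the endpoint of the same sign. -/
lemma clip_mul_soft (hc : 0 ≤ c) (t : ℝ) : clip c t * soft c t = c * |soft c t| := by
  have hclip : clip c t = t - soft c t := by rw [soft]; ring
  rcases le_total c t with h | h
  · rw [hclip, soft_of_le hc h, abs_of_nonneg (by linarith)]; ring
  rcases le_total t (-c) with h' | h'
  · rw [hclip, soft_of_le_neg hc h', abs_of_nonpos (by linarith)]; ring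
  · rw [soft_of_abs_le (abs_le.2 ⟨h', h⟩)]; simp

/-- This is the variational inequality of the projection onto `[-c, c]`. -/
lemma soft_mul_clip_sub_nonneg (hc : 0 ≤ c) (t : ℝ) {z : ℝ} (hz : |z| ≤ c) :
    0 ≤ soft c t * (clip c t - z) := by
  have h1 := clip_mul_soft hc t
  have h2 : z * soft c t ≤ c * |soft c t| := (le_abs_self _).trans (by
    rw [abs_mul]; exact mul_le_mul_of_nonneg_right hz (abs_nonneg _))
  linarith

lemma soft_sq_le (hc : 0 ≤ c) (t : ℝ) {z : ℝ} (hz : |z| ≤ c) : soft c t ^ 2 ≤ (t - z) ^ 2 := by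
  have h1 := soft_mul_clip_sub_nonneg hc t hz
  have h2 : t - z = soft c t + (clip c t - z) := by rw [soft]; ring
  rw [h2]
  nlinarith [sq_nonneg (clip c t - z)]

/-- `soft c t` is the proximal point of `c * |·|` at `t`. -/
lemma soft_prox (hc : 0 ≤ c) (t w : ℝ) :
    c * |soft c t| + 1 / 2 * (soft c t - t) ^ 2 + 1 / 2 * (w - soft c t) ^ 2
      ≤ c * |w| + 1 / 2 * (w - t) ^ 2 := by
  have h1 := clip_mul_soft hc t
  have h2 : clip c t * w ≤ c * |w| := (le_abs_self _).trans (by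
    rw [abs_mul]; exact mul_le_mul_of_nonneg_right (abs_clip_le hc t) (abs_nonneg _))
  have h3 : clip c t = t - soft c t := by rw [soft]; ring
  rw [h3] at h1 h2
  nlinarith

/-- The square of `soft` is the squared distance to `[-c, c]`; at `t + d` it is bounded using the
old projection `clip c t`. -/
lemma half_soft_sq_upper (hc : 0 ≤ c) (t d : ℝ) :
    1 / 2 * soft c (t + d) ^ 2 ≤ 1 / 2 * soft c t ^ 2 + soft c t * d + 1 / 2 * d ^ 2 := by
  have h1 := soft_sq_le hc (t + d) (abs_clip_le hc t)
  have h2 : t + d - clip c t = soft c t + d := by rw [soft]; ring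
  rw [h2] at h1
  linarith

/-- Convexity of half the squared distance, from the variational inequality at `t` tested with the
projection of `t + d`. -/
lemma half_soft_sq_lower (hc : 0 ≤ c) (t d : ℝ) :
    1 / 2 * soft c t ^ 2 + soft c t * d ≤ 1 / 2 * soft c (t + d) ^ 2 := by
  have h1 := soft_mul_clip_sub_nonneg hc t (abs_clip_le hc (t + d))
  have h2 : clip c t - clip c (t + d) = soft c (t + d) - soft c t - d := by
    simp only [soft]; ring
  rw [h2] at h1
  nlinarith [sq_nonneg (soft c (t + d) - soft c t)]

/-- Both `soft` and its complement `clip` are monotone, which confines the derivative to `[0, 1]`.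
-/
lemma IsSlope.of_hasDerivAt (hc : 0 ≤ c) {t u : ℝ} (h : HasDerivAt (soft c) u t) :
    IsSlope c t u := by
  refine ⟨?_, ?_, fun ht => ?_, fun ht => ?_⟩
  · rw [← h.deriv]; exact (soft_monotone c).deriv_nonneg
  · have h1 : HasDerivAt (clip c) (1 - u) t := by
      have := (hasDerivAt_id t).sub h
      refine this.congr_of_eventuallyEq (Eventually.of_forall fun s => ?_)
      simp [soft]
    have h2 : 0 ≤ deriv (clip c) t := (clip_monotone c).deriv_nonneg
    rw [h1.deriv] at h2
    linarith
  · rcases lt_abs.1 ht with ht | ht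
    · refine h.unique (((hasDerivAt_id t).sub_const c).congr_of_eventuallyEq ?_)
      filter_upwards [lt_mem_nhds ht] with s hs
      exact soft_of_le hc (le_of_lt hs)
    · refine h.unique (((hasDerivAt_id t).add_const c).congr_of_eventuallyEq ?_)
      filter_upwards [gt_mem_nhds (show t < -c by linarith)] with s hs
      exact soft_of_le_neg hc (le_of_lt hs)
  · refine h.unique ((hasDerivAt_const t (0 : ℝ)).congr_of_eventuallyEq ?_)
    filter_upwards [continuous_abs.continuousAt.eventually_lt_const ht] with s hs
    exact soft_of_abs_le hs.le

/-- Soft thresholding and half its square have exact expansions near every point. -/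
lemma eventually_soft_expansion (hc : 0 ≤ c) (t : ℝ) : ∀ᶠ s in 𝓝 t, ∀ u, IsSlope c s u →
    soft c s = soft c t + u * (s - t) ∧
    1 / 2 * soft c s ^ 2 = 1 / 2 * soft c t ^ 2 + soft c t * (s - t) + 1 / 2 * (u * (s - t) ^ 2) := by
  have hzero : ∀ {s}, |s| < c → soft c s = 0 := fun h => soft_of_abs_le h.le
  rcases lt_trichotomy |t| c with ht | ht | ht
  · filter_upwards [continuous_abs.continuousAt.eventually_lt_const ht] with s hs u hu
    rw [hzero hs, hzero ht, hu.eq_zero hs]; simp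
  -- At a kink `soft` vanishes and is affine on each side. The ambiguous slope occurs only at `s =
  -- t`, where it multiplies zero; for `c = 0` the kinks merge and `soft` is the identity.
  · have ht0 := soft_of_abs_le ht.le
    rcases hc.eq_or_lt with rfl | hc
    · rw [abs_eq_zero] at ht
      subst ht
      filter_upwards with s u hu
      have h1 : soft 0 s = s := by simp [soft, clip]
      rw [ht0, h1]
      rcases eq_or_ne s 0 with rfl | hs
      · simp
      · rw [hu.eq_one (abs_pos.2 hs)]; simp
    · rcases eq_or_eq_neg_of_abs_eq ht with rfl | rfl
      · filter_upwards [lt_mem_nhds (show -t < t by linarith)] with s hs u hu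
        rw [ht0]
        rcases lt_trichotomy s t with h | rfl | h
        · have h1 : |s| < t := abs_lt.2 ⟨hs, h⟩
          rw [hzero h1, hu.eq_zero h1]; simp
        · rw [ht0]; simp
        · rw [soft_of_le hc.le h.le, hu.eq_one (h.trans_le (le_abs_self _))]
          constructor <;> ring
      · filter_upwards [gt_mem_nhds (show -c < c by linarith)] with s hs u hu
        rw [ht0]
        rcases lt_trichotomy s (-c) with h | rfl | h
        · rw [soft_of_le_neg hc.le h.le, hu.eq_one (lt_abs.2 (Or.inr (by linarith)))]
          constructor <;> ring
        · rw [ht0]; simp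
        · have h1 : |s| < c := abs_lt.2 ⟨h, hs⟩
          rw [hzero h1, hu.eq_zero h1]; simp
  · rcases lt_abs.1 ht with ht | ht
    · filter_upwards [lt_mem_nhds ht] with s hs u hu
      rw [soft_of_le hc ht.le, soft_of_le hc (le_of_lt hs),
        hu.eq_one (lt_of_lt_of_le hs (le_abs_self _))]
      constructor <;> ring
    · have ht' : t < -c := by linarith
      filter_upwards [gt_mem_nhds ht'] with s hs u hu
      have hs' : s < -c := hs
      rw [soft_of_le_neg hc ht'.le, soft_of_le_neg hc hs'.le,
        hu.eq_one (lt_abs.2 (Or.inr (by linarith)))]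
      constructor <;> ring

lemma convex_setOf_isSlope (c t : ℝ) : Convex ℝ {u | IsSlope c t u} := by
  intro u hu v hv a b ha hb hab
  simp only [smul_eq_mul]
  refine ⟨add_nonneg (mul_nonneg ha hu.nonneg) (mul_nonneg hb hv.nonneg), ?_, fun h => ?_,
    fun h => ?_⟩
  · nlinarith [mul_le_mul_of_nonneg_left hu.le_one ha, mul_le_mul_of_nonneg_left hv.le_one hb]
  · simp [hu.eq_one h, hv.eq_one h, hab]
  · simp [hu.eq_zero h, hv.eq_zero h]

/-- Slopes are closed under limits. -/
lemma IsSlope.of_tendsto {t u : ℝ} {ts us : ℕ → ℝ} (h : ∀ k, IsSlope c (ts k) (us k))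
    (ht : Tendsto ts atTop (𝓝 t)) (hu : Tendsto us atTop (𝓝 u)) : IsSlope c t u := by
  refine ⟨ge_of_tendsto' hu fun k => (h k).nonneg, le_of_tendsto' hu fun k => (h k).le_one,
    fun hct => ?_, fun hct => ?_⟩
  · refine tendsto_nhds_unique (hu.congr' ?_) tendsto_const_nhds
    filter_upwards [ht.abs.eventually_const_lt hct] with k hk using (h k).eq_one hk
  · refine tendsto_nhds_unique (hu.congr' ?_) tendsto_const_nhds
    filter_upwards [ht.abs.eventually_lt_const hct] with k hk using (h k).eq_zero hk

end Soft

/-! ### The proximal map of a weighted ℓ¹ norm and its Clarke Jacobian. -/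

section SeparableProx

/-- Quadratic growth around `s` makes it the only minimizer, so the choice operator in `prox` must
return it. -/
lemma prox_eq {E : Type*} [NormedAddCommGroup E] [InnerProductSpace ℝ E] {f : E → ℝ} {v s : E}
    (h : ∀ w, f s + 1 / 2 * ‖s - v‖ ^ 2 + 1 / 2 * ‖w - s‖ ^ 2 ≤ f w + 1 / 2 * ‖w - v‖ ^ 2) :
    prox f v = s := by
  have hs : IsMinOn (fun w => f w + 1 / 2 * ‖w - v‖ ^ 2) Set.univ s := fun w _ => by
    have := h w
    have := sq_nonneg ‖w - s‖
    simp only [Set.mem_ofPred_eq]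
    linarith
  have h1 : IsMinOn (fun w => f w + 1 / 2 * ‖w - v‖ ^ 2) Set.univ (prox f v) :=
    Classical.epsilon_spec (p := fun w =>
      IsMinOn (fun w' => f w' + (1 / 2) * ‖w' - v‖ ^ 2) Set.univ w) ⟨s, hs⟩
  have h2 := h (prox f v)
  have h3 : f (prox f v) + 1 / 2 * ‖prox f v - v‖ ^ 2 ≤ f s + 1 / 2 * ‖s - v‖ ^ 2 :=
    h1 (Set.mem_univ s)
  have h4 : ‖prox f v - s‖ ^ 2 ≤ 0 := by linarith
  exact sub_eq_zero.1
    (norm_eq_zero.1 (pow_eq_zero_iff two_ne_zero |>.1 (le_antisymm h4 (sq_nonneg _))))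

variable {ι : Type*} [Fintype ι]

/-- Componentwise soft thresholding. -/
noncomputable def softVec (c : ι → ℝ) (v : EuclideanSpace ℝ ι) : EuclideanSpace ℝ ι :=
  WithLp.toLp 2 fun k => soft (c k) (v k)

omit [Fintype ι] in
@[simp] lemma softVec_apply (c : ι → ℝ) (v : EuclideanSpace ℝ ι) (k : ι) :
    softVec c v k = soft (c k) (v k) := rfl

variable {c : ι → ℝ} (hc : ∀ k, 0 ≤ c k)
include hc

lemma prox_weighted_l1 : prox (fun w : EuclideanSpace ℝ ι => ∑ k, c k * |w k|) = softVec c := by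
  funext v
  refine prox_eq fun w => ?_
  simp only [EuclideanSpace.real_norm_sq_eq, Finset.mul_sum, ← Finset.sum_add_distrib]
  exact Finset.sum_le_sum fun k _ => soft_prox (hc k) (v k) (w k)

/-- A diagonal entry depends linearly and continuously on `J`, and slopes are stable under limits
and convex combinations, so only points of differentiability matter. -/
lemma isSlope_of_mem_clarkeJacobian [DecidableEq ι] {v : EuclideanSpace ℝ ι}
    {J : EuclideanSpace ℝ ι →L[ℝ] EuclideanSpace ℝ ι} (hJ : J ∈ clarkeJacobian (softVec c) v)
    (k : ι) : IsSlope (c k) (v k) (J (EuclideanSpace.single k 1) k) := by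
  have hconv : Convex ℝ {J : EuclideanSpace ℝ ι →L[ℝ] EuclideanSpace ℝ ι |
      IsSlope (c k) (v k) (J (EuclideanSpace.single k 1) k)} := by
    intro J₁ h₁ J₂ h₂ a b ha hb hab
    have := convex_setOf_isSlope (c k) (v k) h₁ h₂ ha hb hab
    simpa using this
  refine convexHull_min ?_ hconv hJ
  rintro J ⟨w, hw, hwv, hJ⟩
  have hcoord : ∀ y : ℕ → EuclideanSpace ℝ ι, ∀ z, Tendsto y atTop (𝓝 z) →
      Tendsto (fun j => y j k) atTop (𝓝 (z k)) := fun y z h =>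
    ((EuclideanSpace.proj (𝕜 := ℝ) k).continuous.tendsto z).comp h
  refine IsSlope.of_tendsto (ts := fun j => w j k)
    (us := fun j => fderiv ℝ (softVec c) (w j) (EuclideanSpace.single k 1) k) (fun j => ?_)
    (hcoord _ _ hwv) (hcoord _ _ ?_)
  · apply IsSlope.of_hasDerivAt (hc k)
    set e : EuclideanSpace ℝ ι := EuclideanSpace.single k 1
    -- The line is parametrized by its own `k`-th coordinate, so coordinate `k` of `softVec c` along
    -- it is exactly `soft (c k)`.
    have hline : HasDerivAt (fun t : ℝ => w j + (t - w j k) • e) e (w j k) := by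
      simpa using (((hasDerivAt_id (w j k)).sub_const (w j k)).smul_const e).const_add (w j)
    have hw' : HasFDerivAt (softVec c) (fderiv ℝ (softVec c) (w j))
        (w j + (w j k - w j k) • e) := by simpa using (hw j).hasFDerivAt
    have h1 := (EuclideanSpace.proj (𝕜 := ℝ) k).hasFDerivAt.comp_hasDerivAt (w j k)
      (hw'.comp_hasDerivAt (w j k) hline)
    refine h1.congr_of_eventuallyEq (Eventually.of_forall fun t => ?_)
    simp [e]
  · exact ((ContinuousLinearMap.apply ℝ _ (EuclideanSpace.single k (1 : ℝ))).continuous.tendsto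
      J).comp hJ

end SeparableProx

/-! ### Quadratic plus squared soft thresholding of an affine map. -/

section Composite

variable {E : Type*} [NormedAddCommGroup E] [InnerProductSpace ℝ E] [CompleteSpace E]
  {ι : Type*} [Fintype ι]

/-- The squared norm plus a squared soft thresholding of an affine map, up to a constant `C`. -/
noncomputable def softQuad (S : E →L[ℝ] EuclideanSpace ℝ ι) (b : EuclideanSpace ℝ ι) (c : ι → ℝ)
    (σ C : ℝ) (Y : E) : ℝ :=
  1 / 2 * ‖Y‖ ^ 2 + σ * ∑ k, 1 / 2 * soft (c k) ((b - S Y) k) ^ 2 - C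

/-- The gradient of `softQuad`. -/
noncomputable def softQuadGrad (S : E →L[ℝ] EuclideanSpace ℝ ι) (b : EuclideanSpace ℝ ι)
    (c : ι → ℝ) (σ : ℝ) (Y : E) : E :=
  Y - σ • ContinuousLinearMap.adjoint S (softVec c (b - S Y))

variable [DecidableEq ι]

/-- The operator `D ↦ D + σ S* (u ∘ S D)`. -/
noncomputable def hessOp (S : E →L[ℝ] EuclideanSpace ℝ ι) (σ : ℝ) (u : EuclideanSpace ℝ ι) :
    E →ₗ[ℝ] E :=
  (ContinuousLinearMap.id ℝ E + σ • ((ContinuousLinearMap.adjoint S).comp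
    ((Matrix.toEuclideanCLM (𝕜 := ℝ) (Matrix.diagonal fun k => u k)).comp S)) : E →L[ℝ] E)

/-- The generalized Hessians of `softQuad`. -/
noncomputable def softQuadHess (S : E →L[ℝ] EuclideanSpace ℝ ι) (b : EuclideanSpace ℝ ι)
    (c : ι → ℝ) (σ : ℝ) (Y : E) : Set (E →ₗ[ℝ] E) :=
  {V | ∃ u, (∀ k, IsSlope (c k) ((b - S Y) k) (u k)) ∧ V = hessOp S σ u}

lemma toEuclideanCLM_diagonal_apply (u w : EuclideanSpace ℝ ι) :
    Matrix.toEuclideanCLM (𝕜 := ℝ) (Matrix.diagonal fun k => u k) w = had w u := by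
  ext k
  rw [Matrix.ofLp_toEuclideanCLM, Matrix.mulVec_diagonal]
  exact mul_comm _ _

lemma hessOp_apply (S : E →L[ℝ] EuclideanSpace ℝ ι) (σ : ℝ) (u : EuclideanSpace ℝ ι) (D : E) :
    hessOp S σ u D = D + σ • ContinuousLinearMap.adjoint S (had (S D) u) := by
  rw [← toEuclideanCLM_diagonal_apply]; rfl

lemma inner_hessOp (S : E →L[ℝ] EuclideanSpace ℝ ι) (σ : ℝ) (u : EuclideanSpace ℝ ι) (X D : E) :
    ⟪X, hessOp S σ u D⟫ = ⟪X, D⟫ + σ * ∑ k, u k * (S X k * S D k) := by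
  rw [hessOp_apply, inner_add_right, inner_smul_right, ContinuousLinearMap.adjoint_inner_right,
    PiLp.inner_apply]
  congr 2
  refine Finset.sum_congr rfl fun k _ => ?_
  simp only [had, RCLike.inner_apply, conj_trivial]
  ring

lemma hessOp_isSymmetric (S : E →L[ℝ] EuclideanSpace ℝ ι) (σ : ℝ) (u : EuclideanSpace ℝ ι) :
    (hessOp S σ u).IsSymmetric := by
  intro X D
  rw [real_inner_comm, inner_hessOp, inner_hessOp, real_inner_comm]
  congr 2
  exact Finset.sum_congr rfl fun k _ => by ring

variable {S : E →L[ℝ] EuclideanSpace ℝ ι} {b : EuclideanSpace ℝ ι} {c : ι → ℝ} {σ : ℝ}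

lemma hessOp_coercive (hσ : 0 ≤ σ) {u : EuclideanSpace ℝ ι} (hu : ∀ k, 0 ≤ u k) (D : E) :
    ‖D‖ ^ 2 ≤ ⟪D, hessOp S σ u D⟫ := by
  rw [inner_hessOp, real_inner_self_eq_norm_sq]
  have : 0 ≤ ∑ k, u k * (S D k * S D k) :=
    Finset.sum_nonneg fun k _ => mul_nonneg (hu k) (mul_self_nonneg _)
  have := mul_nonneg hσ this
  linarith

omit [DecidableEq ι] in
lemma norm_had_le {u w : EuclideanSpace ℝ ι} (h0 : ∀ k, 0 ≤ u k) (h1 : ∀ k, u k ≤ 1) :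
    ‖had w u‖ ≤ ‖w‖ := by
  refine (sq_le_sq₀ (norm_nonneg _) (norm_nonneg _)).1 ?_
  rw [EuclideanSpace.real_norm_sq_eq, EuclideanSpace.real_norm_sq_eq]
  refine Finset.sum_le_sum fun k _ => ?_
  have h2 : u k ^ 2 ≤ 1 := pow_le_one₀ (h0 k) (h1 k)
  have h3 : had w u k = w k * u k := rfl
  rw [h3, mul_pow]
  exact mul_le_of_le_one_right (sq_nonneg _) h2

lemma norm_hessOp_le (hσ : 0 ≤ σ) {u : EuclideanSpace ℝ ι} (h0 : ∀ k, 0 ≤ u k)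
    (h1 : ∀ k, u k ≤ 1) (D : E) : ‖hessOp S σ u D‖ ≤ (1 + σ * ‖S‖ ^ 2) * ‖D‖ := by
  rw [hessOp_apply]
  refine (norm_add_le _ _).trans ?_
  rw [norm_smul, Real.norm_of_nonneg hσ]
  have h2 : ‖ContinuousLinearMap.adjoint S (had (S D) u)‖ ≤ ‖S‖ * (‖S‖ * ‖D‖) := by
    refine (ContinuousLinearMap.le_opNorm _ _).trans ?_
    rw [LinearIsometryEquiv.norm_map]
    exact mul_le_mul_of_nonneg_left ((norm_had_le h0 h1).trans (S.le_opNorm D)) (norm_nonneg _)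
  have := mul_le_mul_of_nonneg_left h2 hσ
  linarith

omit [DecidableEq ι] in
lemma inner_softQuadGrad (Y D : E) : ⟪softQuadGrad S b c σ Y, D⟫
    = ⟪Y, D⟫ + σ * ∑ k, soft (c k) ((b - S Y) k) * -(S D k) := by
  rw [softQuadGrad, inner_sub_left, real_inner_smul_left,
    ContinuousLinearMap.adjoint_inner_left, PiLp.inner_apply]
  simp only [RCLike.inner_apply, conj_trivial, softVec_apply, mul_neg, Finset.sum_neg_distrib,
    sub_eq_add_neg]
  congr 3
  exact Finset.sum_congr rfl fun k _ => mul_comm _ _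

/-- Every clause sums the scalar facts about `soft` over the coordinates; `σ‖S‖²` enters the
constant through `‖S D‖ ≤ ‖S‖‖D‖`. -/
theorem piecewiseQuadratic_softQuad (hσ : 0 ≤ σ) (hc : ∀ k, 0 ≤ c k) (C : ℝ) :
    PiecewiseQuadratic (softQuad S b c σ C) (softQuadGrad S b c σ) (1 + σ * ‖S‖ ^ 2)
      (softQuadHess S b c σ) := by
  have hshift : ∀ Y D k, (b - S (Y + D)) k = (b - S Y) k + -(S D k) := by
    intro Y D k
    simp only [map_add, PiLp.sub_apply, PiLp.add_apply]; ring
  have hnorm : ∀ Y D : E, ‖Y + D‖ ^ 2 = ‖Y‖ ^ 2 + 2 * ⟪Y, D⟫ + ‖D‖ ^ 2 := norm_add_sq_real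
  refine ⟨?_, fun Y D => ?_, fun Y D => ?_, ?_, ?_, fun Z => ?_⟩
  · have := mul_nonneg hσ (sq_nonneg ‖S‖)
    linarith
  · rw [softQuad, softQuad, inner_softQuadGrad, hnorm]
    have h1 := mul_le_mul_of_nonneg_left (Finset.sum_le_sum fun k (_ : k ∈ Finset.univ) =>
      half_soft_sq_lower (hc k) ((b - S Y) k) (-(S D k))) hσ
    simp only [hshift]
    rw [Finset.sum_add_distrib, mul_add] at h1
    linarith
  · rw [softQuad, softQuad, inner_softQuadGrad, hnorm]
    have h1 := mul_le_mul_of_nonneg_left (Finset.sum_le_sum fun k (_ : k ∈ Finset.univ) =>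
      half_soft_sq_upper (hc k) ((b - S Y) k) (-(S D k))) hσ
    simp only [hshift]
    rw [Finset.sum_add_distrib, Finset.sum_add_distrib, mul_add, mul_add,
      ← Finset.mul_sum _ _ (1 / 2 : ℝ)] at h1
    have h2 : ∑ k, (-(S D k)) ^ 2 = ‖S D‖ ^ 2 := by
      simp only [neg_sq, EuclideanSpace.real_norm_sq_eq]
    rw [← Finset.mul_sum _ (fun k => (-(S D k)) ^ 2), h2] at h1
    have h3 : ‖S D‖ ^ 2 ≤ ‖S‖ ^ 2 * ‖D‖ ^ 2 := by
      rw [← mul_pow]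
      exact pow_le_pow_left₀ (norm_nonneg _) (S.le_opNorm D) 2
    have h4 := mul_le_mul_of_nonneg_left h3 hσ
    rw [← Finset.mul_sum _ _ (1 / 2 : ℝ)]
    linarith
  · rintro Y V ⟨u, hu, rfl⟩ D
    exact hessOp_coercive hσ (fun k => (hu k).nonneg) D
  · rintro Y V ⟨u, hu, rfl⟩ D
    exact norm_hessOp_le hσ (fun k => (hu k).nonneg) (fun k => (hu k).le_one) D
  · have h1 : ∀ᶠ Y in 𝓝 Z, ∀ k, ∀ r, IsSlope (c k) ((b - S Y) k) r →
        soft (c k) ((b - S Y) k) = soft (c k) ((b - S Z) k)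
          + r * ((b - S Y) k - (b - S Z) k) ∧
        1 / 2 * soft (c k) ((b - S Y) k) ^ 2 = 1 / 2 * soft (c k) ((b - S Z) k) ^ 2
          + soft (c k) ((b - S Z) k) * ((b - S Y) k - (b - S Z) k)
          + 1 / 2 * (r * ((b - S Y) k - (b - S Z) k) ^ 2) := by
      -- Finitely many coordinates share a common neighbourhood.
      rw [eventually_all]
      intro k
      have hcont : Continuous fun Y : E => (b - S Y) k :=
        (EuclideanSpace.proj (𝕜 := ℝ) k).continuous.comp (continuous_const.sub S.continuous)
      exact (hcont.tendsto Z).eventually (eventually_soft_expansion (hc k) _)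
    filter_upwards [h1] with Y hY
    rintro V ⟨u, hu, rfl⟩
    obtain ⟨D, rfl⟩ : ∃ D, Y = Z + D := ⟨Y - Z, by abel⟩
    have hY' := fun k => hY k _ (hu k)
    simp only [hshift, add_sub_cancel_left] at hY'
    rw [add_sub_cancel_left]
    constructor
    · have h2 : softVec c (b - S (Z + D)) = softVec c (b - S Z) - had (S D) u := by
        ext k
        have h3 : had (S D) u k = S D k * u k := rfl
        rw [PiLp.sub_apply, softVec_apply, softVec_apply, hshift, (hY' k).1, h3]
        ring
      rw [softQuadGrad, softQuadGrad, hessOp_apply, h2, map_sub, smul_sub]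
      abel
    · rw [softQuad, softQuad, inner_softQuadGrad, inner_hessOp, hnorm, real_inner_self_eq_norm_sq]
      have h2 : ∑ k, 1 / 2 * soft (c k) ((b - S (Z + D)) k) ^ 2
          = ∑ k, 1 / 2 * soft (c k) ((b - S Z) k) ^ 2
            + ∑ k, soft (c k) ((b - S Z) k) * -(S D k)
            + 1 / 2 * ∑ k, u k * (S D k * S D k) := by
        rw [Finset.mul_sum, ← Finset.sum_add_distrib, ← Finset.sum_add_distrib]
        refine Finset.sum_congr rfl fun k _ => ?_
        rw [hshift, (hY' k).2]
        ring
      rw [h2]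
      ring

end Composite

/-! ### The given `ψ` and Newton operator in the abstract framework. -/

section Concrete

variable {p n : ℕ}

/-- The operator `opS` as a continuous linear map. -/
noncomputable def opSL (A : Matrix (Fin p) (Fin n) ℝ) (I : Finset (Fin p × Fin p)) :
    MatSpace p n →L[ℝ] VecSpace I :=
  LinearMap.toContinuousLinearMap
    { toFun := opS A I
      map_add' := fun X Y => by
        ext k
        simp only [opS, opL, toMat, Matrix.add_apply, Matrix.mul_apply, Matrix.transpose_apply,
          Matrix.of_apply, PiLp.add_apply, PiLp.smul_apply, smul_eq_mul, add_mul, mul_add,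
          Finset.sum_add_distrib]
        ring
      map_smul' := fun r X => by
        ext k
        simp only [opS, opL, toMat, Matrix.add_apply, Matrix.mul_apply, Matrix.transpose_apply,
          Matrix.of_apply, PiLp.smul_apply, smul_eq_mul, RingHom.id_apply, mul_add,
          Finset.mul_sum]
        congr 1 <;> exact Finset.sum_congr rfl fun _ _ => by ring }

@[simp] lemma opSL_apply (A : Matrix (Fin p) (Fin n) ℝ) (I : Finset (Fin p × Fin p))
    (Y : MatSpace p n) : opSL A I Y = opS A I Y := rfl

/-- The threshold at each position: `lam` off the diagonal and `0` on it. -/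
noncomputable def threshold (I : Finset (Fin p × Fin p)) (lam : ℝ) (k : UpperIdx I) : ℝ :=
  lam / 2 * e2 I k

lemma e1_apply (I : Finset (Fin p × Fin p)) (k : UpperIdx I) :
    e1 I k = if k.1.1 = k.1.2 then 1 else 0 := Matrix.one_apply

lemma e2_apply (I : Finset (Fin p × Fin p)) (k : UpperIdx I) :
    e2 I k = 2 * (1 - if k.1.1 = k.1.2 then 1 else 0) := by
  rw [← Matrix.one_apply]; rfl

lemma e3_apply (I : Finset (Fin p × Fin p)) (k : UpperIdx I) :
    e3 I k = if k.1.1 = k.1.2 then 1 else 1 / 2 := by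
  have : e3 I k = e1 I k + 1 / 4 * e2 I k := rfl
  rw [this, e1_apply, e2_apply]
  split_ifs <;> norm_num

lemma threshold_apply (I : Finset (Fin p × Fin p)) (lam : ℝ) (k : UpperIdx I) :
    threshold I lam k = if k.1.1 = k.1.2 then 0 else lam := by
  rw [threshold, e2_apply]
  split_ifs <;> ring

lemma threshold_nonneg (I : Finset (Fin p × Fin p)) {lam : ℝ} (hlam : 0 ≤ lam)
    (k : UpperIdx I) : 0 ≤ threshold I lam k := by
  rw [threshold_apply]
  split_ifs
  · exact le_rfl
  · exact hlam

lemma phi_eq (I : Finset (Fin p × Fin p)) (lam : ℝ) :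
    phi I lam = fun v => ∑ k, threshold I lam k * |v k| := by
  funext v
  rw [phi, Finset.mul_sum]
  refine Finset.sum_congr rfl fun k _ => ?_
  have h1 : had v (e2 I) k = v k * e2 I k := rfl
  have h2 : 0 ≤ e2 I k := by rw [e2_apply]; split_ifs <;> norm_num
  rw [h1, abs_mul, abs_of_nonneg h2, threshold]
  ring

lemma mem_box_iff (I : Finset (Fin p × Fin p)) {lam : ℝ} (hlam : 0 ≤ lam) (z : VecSpace I) :
    z ∈ box I lam ↔ ∀ k, |z k| ≤ threshold I lam k := by
  have h1 : had (e1 I) z = 0 ↔ ∀ k, e1 I k * z k = 0 := by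
    rw [PiLp.ext_iff]; rfl
  have h2 : z ∈ box I lam ↔ had (e1 I) z = 0 ∧ ∀ k, |z k| ≤ lam := Iff.rfl
  rw [h2, h1, ← forall_and]
  refine forall_congr' fun k => ?_
  rw [e1_apply, threshold_apply]
  split_ifs
  · rw [one_mul, abs_nonpos_iff]
    exact ⟨fun h => h.1, fun h => ⟨h, by simpa [h] using hlam⟩⟩
  · simp

/-- Completing the square in `r = S(Y) + z - e₁` separates the coordinates of `z`. -/
lemma augLagrangian_eq (A : Matrix (Fin p) (Fin n) ℝ) (I : Finset (Fin p × Fin p)) {σ : ℝ}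
    (hσ : 0 < σ) (x : VecSpace I) (Y : MatSpace p n) (z : VecSpace I) :
    augLagrangian A I σ x Y z = 1 / 2 * ‖Y‖ ^ 2
      + σ * ∑ k, 1 / 2 * (((1 / σ) • x + e1 I - opSL A I Y) k - z k) ^ 2
      - ‖x‖ ^ 2 / (2 * σ) := by
  have h1 : ∑ k, 1 / 2 * (((1 / σ) • x + e1 I - opSL A I Y) k - z k) ^ 2
      = 1 / 2 * ‖(1 / σ) • x - (opS A I Y + z - e1 I)‖ ^ 2 := by
    rw [EuclideanSpace.real_norm_sq_eq, Finset.mul_sum]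
    refine Finset.sum_congr rfl fun k _ => ?_
    simp only [PiLp.sub_apply, PiLp.add_apply, opSL_apply]
    ring
  rw [h1, augLagrangian]
  generalize opS A I Y + z - e1 I = r
  rw [norm_sub_sq_real, norm_smul, real_inner_smul_left,
    real_inner_comm x, Real.norm_of_nonneg (by positivity)]
  field_simp
  ring

lemma psi_eq (A : Matrix (Fin p) (Fin n) ℝ) (I : Finset (Fin p × Fin p)) {σ lam : ℝ}
    (hσ : 0 < σ) (hlam : 0 ≤ lam) (x : VecSpace I) :
    psi A I σ lam x = softQuad (opSL A I) ((1 / σ) • x + e1 I) (threshold I lam) σ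
      (‖x‖ ^ 2 / (2 * σ)) := by
  funext Y
  have hlb : ∀ z : box I lam, softQuad (opSL A I) ((1 / σ) • x + e1 I) (threshold I lam) σ
      (‖x‖ ^ 2 / (2 * σ)) Y ≤ augLagrangian A I σ x Y z := by
    rintro ⟨z, hz⟩
    rw [mem_box_iff I hlam] at hz
    rw [augLagrangian_eq A I hσ, softQuad]
    have := mul_le_mul_of_nonneg_left (Finset.sum_le_sum fun k (_ : k ∈ Finset.univ) =>
      mul_le_mul_of_nonneg_left (soft_sq_le (threshold_nonneg I hlam k)
        (((1 / σ) • x + e1 I - opSL A I Y) k) (hz k)) (one_half_pos (α := ℝ)).le) hσ.le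
    linarith
  -- The infimum is attained at the coordinatewise projection onto the box.
  set z₀ : VecSpace I := WithLp.toLp 2 fun k =>
    clip (threshold I lam k) (((1 / σ) • x + e1 I - opSL A I Y) k) with hz₀
  have hmem : z₀ ∈ box I lam :=
    (mem_box_iff I hlam _).2 fun k => abs_clip_le (threshold_nonneg I hlam k) _
  have hval : augLagrangian A I σ x Y z₀ = softQuad (opSL A I) ((1 / σ) • x + e1 I)
      (threshold I lam) σ (‖x‖ ^ 2 / (2 * σ)) Y := by
    rw [augLagrangian_eq A I hσ, softQuad]; rfl
  have : Nonempty (box I lam) := ⟨⟨z₀, hmem⟩⟩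
  refine le_antisymm ?_ (le_ciInf hlb)
  rw [← hval]
  exact ciInf_le (f := fun z : box I lam => augLagrangian A I σ x Y z)
    ⟨_, by rintro _ ⟨z, rfl⟩; exact hlb z⟩ ⟨z₀, hmem⟩

/-- The sum of a symmetric array over all positions is a weighted sum over the upper triangle. -/
lemma sum_sum_eq_sum_upper {f : Fin p → Fin p → ℝ} (hf : ∀ i j, f i j = f j i) :
    ∑ i, ∑ j, f i j
      = ∑ i, ∑ j, if i ≤ j then (if i = j then 1 else 2) * f i j else 0 := by
  -- The two strict-triangle corrections are transposes of each other and cancel after summation.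
  have h1 : ∀ i j, f i j = (if i ≤ j then (if i = j then 1 else 2) * f i j else 0)
      - (if i < j then f i j else 0) + (if j < i then f j i else 0) := by
    intro i j
    rcases lt_trichotomy i j with h | rfl | h
    · rw [if_pos h.le, if_neg h.ne, if_pos h, if_neg h.not_gt]; ring
    · simp
    · rw [if_neg h.not_ge, if_neg h.not_gt, if_pos h, hf]; ring
  have h2 : ∑ i, ∑ j, (if j < i then f j i else 0) = ∑ i, ∑ j, if i < j then f i j else 0 :=
    Finset.sum_comm
  rw [Finset.sum_congr rfl fun i _ => Finset.sum_congr rfl fun j _ => h1 i j]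
  simp only [Finset.sum_add_distrib, Finset.sum_sub_distrib]
  rw [h2]
  ring

lemma opLdag_symm (I : Finset (Fin p × Fin p)) (ω : VecSpace I) (i j : Fin p) :
    opLdag I ω i j = opLdag I ω j i := by
  simp only [opLdag, Matrix.of_apply, min_comm i j, max_comm i j]

lemma opLdag_of_le (I : Finset (Fin p × Fin p)) (ω : VecSpace I) {i j : Fin p} (h : i ≤ j) :
    opLdag I ω i j = if h' : i ≤ j ∧ (i, j) ∈ I then ω ⟨(i, j), h'⟩ else 0 := by
  simp only [opLdag, Matrix.of_apply, min_eq_left h, max_eq_right h]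

/-- Pairing `L†(ω ∘ e₃)` with a symmetric matrix `N` is pairing `ω` with `L(N)`. -/
lemma sum_opLdag_had_e3_mul (I : Finset (Fin p × Fin p)) (ω : VecSpace I)
    (N : Fin p → Fin p → ℝ) :
    ∑ i, ∑ j, opLdag I (had ω (e3 I)) i j * N i j
      = ∑ k : UpperIdx I, ω k * (1 / 2 * (N k.1.1 k.1.2 + N k.1.2 k.1.1)) := by
  set W := opLdag I (had ω (e3 I)) with hW
  have hsw : ∑ i, ∑ j, W i j * N i j = ∑ i, ∑ j, W i j * N j i := by
    rw [Finset.sum_comm]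
    exact Finset.sum_congr rfl fun i _ => Finset.sum_congr rfl fun j _ => by
      rw [hW, opLdag_symm]
  -- As `W` is symmetric, only the symmetric part of `N` contributes.
  have h1 : ∑ i, ∑ j, W i j * N i j = ∑ i, ∑ j, W i j * (1 / 2 * (N i j + N j i)) := by
    have : ∀ i j, W i j * (1 / 2 * (N i j + N j i))
        = 1 / 2 * (W i j * N i j) + 1 / 2 * (W i j * N j i) := fun i j => by ring
    simp only [this, Finset.sum_add_distrib, ← Finset.mul_sum]
    rw [← hsw]
    ring
  rw [h1, sum_sum_eq_sum_upper fun i j => by rw [hW, opLdag_symm, add_comm (N i j)],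
    ← Fintype.sum_prod_type' (f := fun i j => if i ≤ j then (if i = j then 1 else 2) *
      (W i j * (1 / 2 * (N i j + N j i))) else 0)]
  -- The weight `1/2` of `e₃` off the diagonal cancels the double count of off-diagonal positions.
  have h2 : ∀ ij : Fin p × Fin p, (if ij.1 ≤ ij.2 then (if ij.1 = ij.2 then 1 else 2) *
      (W ij.1 ij.2 * (1 / 2 * (N ij.1 ij.2 + N ij.2 ij.1))) else 0)
      = if h : ij.1 ≤ ij.2 ∧ ij ∈ I then
          ω ⟨ij, h⟩ * (1 / 2 * (N ij.1 ij.2 + N ij.2 ij.1)) else 0 := by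
    rintro ⟨i, j⟩
    by_cases hij : i ≤ j
    · simp only [hW, opLdag_of_le I _ hij]
      by_cases hI : (i, j) ∈ I
      · have h3 : had ω (e3 I) ⟨(i, j), hij, hI⟩
            = ω ⟨(i, j), hij, hI⟩ * e3 I ⟨(i, j), hij, hI⟩ := rfl
        simp only [hij, hI, and_self, dif_pos, if_true, h3, e3_apply]
        split_ifs <;> ring
      · simp [hI]
    · simp [hij]
  rw [Finset.sum_congr rfl fun ij _ => h2 ij, Finset.sum_dite, Finset.sum_const_zero, add_zero]
  refine Finset.sum_bij' (fun k _ => ⟨k.1, (Finset.mem_filter.1 k.2).2⟩)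
    (fun k _ => ⟨k.1, Finset.mem_filter.2 ⟨Finset.mem_univ _, k.2⟩⟩) ?_ ?_ ?_ ?_ ?_ <;>
    simp

/-- This identifies the adjoint of `S`. The array `N` in the proof is `D Aᵀ`, whose symmetric part
is sent to `S(D)` by `L`. -/
lemma inner_ofMat_opLdag (A : Matrix (Fin p) (Fin n) ℝ) (I : Finset (Fin p × Fin p))
    (ω : VecSpace I) (D : MatSpace p n) :
    ⟪ofMat (opLdag I (had ω (e3 I)) * A), D⟫ = ⟪ω, opS A I D⟫ := by
  set N : Fin p → Fin p → ℝ := fun i l => ∑ j, A l j * D (i, j) with hN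
  have h1 : ⟪ofMat (opLdag I (had ω (e3 I)) * A), D⟫
      = ∑ i, ∑ l, opLdag I (had ω (e3 I)) i l * N i l := by
    rw [PiLp.inner_apply, Fintype.sum_prod_type]
    refine Finset.sum_congr rfl fun i _ => ?_
    simp only [RCLike.inner_apply, conj_trivial, ofMat, Matrix.mul_apply, hN, Finset.mul_sum]
    rw [Finset.sum_comm]
    exact Finset.sum_congr rfl fun l _ => Finset.sum_congr rfl fun j _ => by ring
  rw [h1, sum_opLdag_had_e3_mul, PiLp.inner_apply]
  refine Finset.sum_congr rfl fun k _ => ?_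
  simp only [RCLike.inner_apply, conj_trivial, opS, opL, toMat, hN, Matrix.add_apply,
    Matrix.mul_apply, Matrix.transpose_apply, Matrix.of_apply, PiLp.smul_apply, smul_eq_mul]
  have h2 : ∀ i l, ∑ j, A l j * D (i, j) = ∑ j, D (i, j) * A l j := fun i l =>
    Finset.sum_congr rfl fun j _ => mul_comm _ _
  rw [h2 k.1.1]
  ring

lemma newtonOp_eq (A : Matrix (Fin p) (Fin n) ℝ) (I : Finset (Fin p × Fin p)) (σ : ℝ)
    (u : VecSpace I) : newtonOp A I σ u = hessOp (opSL A I) σ u := by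
  funext D
  rw [hessOp_apply, newtonOp]
  congr 2
  refine ext_inner_right ℝ fun X => ?_
  rw [inner_ofMat_opLdag, ContinuousLinearMap.adjoint_inner_left]
  rfl

lemma isSlope_of_memProxJacobian (I : Finset (Fin p × Fin p)) {lam : ℝ} (hlam : 0 ≤ lam)
    {v u : VecSpace I} (h : MemProxJacobian I lam v u) (k : UpperIdx I) :
    IsSlope (threshold I lam k) (v k) (u k) := by
  rw [MemProxJacobian, phi_eq, prox_weighted_l1 (threshold_nonneg I hlam)] at h
  have h1 := isSlope_of_mem_clarkeJacobian (threshold_nonneg I hlam) h k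
  rw [toEuclideanCLM_diagonal_apply] at h1
  simpa [had] using h1

/-- The semismooth Newton method for `ψ` is an inexact Newton method. -/
lemma SSNStep.inexactNewtonStep {A : Matrix (Fin p) (Fin n) ℝ} {I : Finset (Fin p × Fin p)}
    {σ lam : ℝ} (hσ : 0 < σ) (hlam : 0 ≤ lam) {x : VecSpace I} {μ ηbar τ δ : ℝ}
    {Y Y' : MatSpace p n} (h : SSNStep A I σ lam x μ ηbar τ δ Y Y') :
    InexactNewtonStep (psi A I σ lam x)
      (softQuadGrad (opSL A I) ((1 / σ) • x + e1 I) (threshold I lam) σ)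
      (softQuadHess (opSL A I) ((1 / σ) • x + e1 I) (threshold I lam) σ) μ ηbar τ δ Y Y' := by
  obtain ⟨u, D, m, hu, ⟨i, hi⟩, hres, hm, hY'⟩ := h
  have hgrad : ∇ (psi A I σ lam x) Y
      = softQuadGrad (opSL A I) ((1 / σ) • x + e1 I) (threshold I lam) σ Y := by
    rw [psi_eq A I hσ hlam]
    exact ((piecewiseQuadratic_softQuad hσ.le (threshold_nonneg I hlam) _).hasGradientAt
      Y).gradient
  have hslope := isSlope_of_memProxJacobian I hlam hu
  rw [show (1 / σ) • x - opS A I Y + e1 I = (1 / σ) • x + e1 I - opSL A I Y by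
    rw [opSL_apply]; abel] at hslope
  simp only [Armijo, hgrad] at hm
  rw [newtonOp_eq, hgrad] at hi hres
  refine ⟨_, ⟨u, hslope, rfl⟩, D, m, ?_, hres, hm, hY'⟩
  have h1 := inner_cgIterate (hessOp_isSymmetric (opSL A I) σ u)
    (hessOp_coercive hσ.le fun k => (hslope k).nonneg)
    (-softQuadGrad (opSL A I) ((1 / σ) • x + e1 I) (threshold I lam) σ Y) i
  rw [← hi, inner_neg_left] at h1
  linarith

end Concrete

end SSN

theorem mainTheorem3 (p n : ℕ) (A : Matrix (Fin p) (Fin n) ℝ)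
    (I : Finset (Fin p × Fin p))
    (hI_symm : ∀ i j, (i, j) ∈ I → (j, i) ∈ I) (hI_diag : ∀ i, (i, i) ∈ I)
    (σ lam : ℝ) (hσ : 0 < σ) (hlam : 0 < lam) (x : SSN.VecSpace I)
    (μ ηbar τ δ : ℝ) (hμ : μ ∈ Set.Ioo (0 : ℝ) (1 / 2)) (hη : ηbar ∈ Set.Ioo (0 : ℝ) 1)
    (hτ : τ ∈ Set.Ioc (0 : ℝ) 1) (hδ : δ ∈ Set.Ioo (0 : ℝ) 1)
    (Y : ℕ → SSN.MatSpace p n)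
    (hY : ∀ j, SSN.SSNStep A I σ lam x μ ηbar τ δ (Y j) (Y (j + 1))) :
    (∃ c : ℝ, 0 < c ∧ StrongConvexOn Set.univ c (SSN.psi A I σ lam x)) ∧
    ∃ Ybar : SSN.MatSpace p n,
      (∀ Z, IsMinOn (SSN.psi A I σ lam x) Set.univ Z ↔ Z = Ybar) ∧
      Tendsto Y atTop (𝓝 Ybar) ∧
      (fun j => ‖Y (j + 1) - Ybar‖) =O[atTop] (fun j => ‖Y j - Ybar‖ ^ (1 + τ)) := by
  have hc := SSN.threshold_nonneg I hlam.le
  have h := SSN.piecewiseQuadratic_softQuad (S := SSN.opSL A I) (b := (1 / σ) • x + SSN.e1 I)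
    hσ.le hc (‖x‖ ^ 2 / (2 * σ))
  rw [← SSN.psi_eq A I hσ hlam.le x] at h
  have hstep := fun j => (hY j).inexactNewtonStep hσ hlam.le
  obtain ⟨Ybar, hmin⟩ := h.exists_forall_le
  exact ⟨⟨1, one_pos, h.strongConvexOn⟩, Ybar, h.isMinOn_iff hmin,
    h.tendsto_minimizer hmin hμ hη hτ.1 hδ hstep, h.isBigO_norm_sub hmin hμ hη hτ.1 hδ hstep⟩
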